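/- Consider a bandit with $K$ arms. Pulling arm $k$ at epoch $n\ge 1$ incurs a cost $X_{n,k}$, yields a reward $R_{n,k}$ and a penalty $Y_{n,k}$, all in $[0,1]$. The triples $(X_{n,k},R_{n,k},Y_{n,k})$ are independent over all $n$ and $k$ and, for each $k$, identically distributed over $n$, with $\mathbb E[X_{1,k}]>0$ for all $k$. A causal policy $\pi$ is a sequence of arm choices $I_n^\pi$, where $I_n^\pi$ is determined by the arms pulled and the outcomes observed at the epochs before $n$ and by a random seed that is independent of all outcomes. Write $X_n^\pi=X_{n,I_n^\pi}$, and similarly $R_n^\pi$, $Y_n^\pi$. For a budget $B>0$ let $N^\pi(B)=\inf\{n\ge 1:\sum_{i=1}^n X_i^\pi>B\}$. Fix $c\in\mathbb R$ and put $$\mathrm{REW}^\pi(B)=\sum_{n=1}^{N^\pi(B)}R_n^\pi,\qquad D^\pi(B)=\mathbb E\Big[\frac1B\sum_{n=1}^{N^\pi(B)}Y_n^\pi\Big]-c .$$ Call $\pi$ feasible for $B$ if it is causal and $D^\pi(B)\le 0$. Let $\mathrm{OPT}(B)$ be the supremum of $\mathbb E[\mathrm{REW}^\pi(B)]$ over the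 policies $\pi$ that are feasible for $B$, and let $\mathrm{REG}^\pi(B)=\mathrm{OPT}(B)-\mathbb E[\mathrm{REW}^\pi(B)]$. For $\mathbf p$ in the probability simplex $\Delta_K$ let $$r(\mathbf p)=\frac{\sum_k p_k\mathbb E[R_{1,k}]}{\sum_k p_k\mathbb E[X_{1,k}]},\qquad y(\mathbf p)=\frac{\sum_k p_k\mathbb E[Y_{1,k}]}{\sum_k p_k\mathbb E[X_{1,k}]}.$$ Let $\mathbf p^*$ maximize $r(\mathbf p)$ over all $\mathbf p\in\Delta_K$ with $y(\mathbf p)\le c$, and let $\pi^*$ be the policy that pulls arms i.i.d. according to $\mathbf p^*$, drawing them from the seed (so independently of all outcomes). Then $N^\pi(B)<\infty$ almost surely for every causal $\pi$ and every $B>0$, and the cumulative reward and the cumulative penalty are integrable. The policy $\pi^*$ is causal. For every $B>0$ the expected rewards of the feasible policies are bounded above. If $\mathbb E[Y_{1,k}]<c\,\mathbb E[X_{1,k}]$ for some arm $k$ (Slater condition), then a feasible policy exists for all sufficiently large $B$. Moreover, there is a constant $C$, not depending on $B$, such that: 1. $|\mathrm{REG}^{\pi^*}(B)|\le C$ for every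 $B>0$ for which a feasible policy exists; 2. $D^{\pi^*}(B)\le C/B$ for every $B>0$, and $|D^{\pi^*}(B)|\le C/B$ for every $B>0$ if the penalty constraint is active, that is, if $y(\mathbf p^*)=c$. Consequently $\pi^*$ is asymptotically optimal: $\mathrm{REG}^{\pi^*}(B)/B\to0$ as $B\to\infty$ along the budgets for which a feasible policy exists, and $\max\{D^{\pi^*}(B),0\}\to0$ as $B\to\infty$; if $y(\mathbf p^*)=c$, then also $D^{\pi^*}(B)\to0$. -/

import Mathlib

open MeasureTheory ProbabilityTheory Filter Topology

/-- A `K`-armed bandit with knapsack cost, reward and penalty, on a probability space `(Ω, P)`.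
Epochs are numbered from `0`: the entry with index `n` is the outcome of the `(n+1)`-st pull.
`U` is a random seed, independent of all outcomes, from which a policy may randomize
(a one-point `𝒰` leaves only the non-randomized policies). -/
structure BanditModel (K : ℕ) {Ω : Type*} [MeasurableSpace Ω] (P : Measure Ω)
    (𝒰 : Type*) [MeasurableSpace 𝒰] where
  /-- cost of arm `k` at epoch `n` -/
  X : ℕ → Fin K → Ω → ℝ
  /-- reward of arm `k` at epoch `n` -/
  R : ℕ → Fin K → Ω → ℝ
  /-- penalty of arm `k` at epoch `n` -/
  Y : ℕ → Fin K → Ω → ℝ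
  /-- seed for randomized decisions -/
  U : Ω → 𝒰
  measurable_X : ∀ n k, Measurable (X n k)
  measurable_R : ∀ n k, Measurable (R n k)
  measurable_Y : ∀ n k, Measurable (Y n k)
  measurable_U : Measurable U
  X_mem : ∀ n k ω, X n k ω ∈ Set.Icc (0 : ℝ) 1
  R_mem : ∀ n k ω, R n k ω ∈ Set.Icc (0 : ℝ) 1
  Y_mem : ∀ n k ω, Y n k ω ∈ Set.Icc (0 : ℝ) 1
  /-- the outcome triples are independent over epochs and across arms -/
  indep : iIndepFun (fun (i : ℕ × Fin K) (ω : Ω) =>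
    (X i.1 i.2 ω, R i.1 i.2 ω, Y i.1 i.2 ω)) P
  /-- the outcome triples of one arm are identically distributed over epochs -/
  ident : ∀ n k, IdentDistrib (fun ω => (X n k ω, R n k ω, Y n k ω))
    (fun ω => (X 0 k ω, R 0 k ω, Y 0 k ω)) P P
  /-- the seed is independent of the whole array of outcomes -/
  indep_seed : IndepFun U (fun (ω : Ω) (n : ℕ) (k : Fin K) =>
    (X n k ω, R n k ω, Y n k ω)) P

namespace BanditModel

variable {K : ℕ} {Ω : Type*} [MeasurableSpace Ω] {P : Measure Ω}
  {𝒰 : Type*} [MeasurableSpace 𝒰] (M : BanditModel K P 𝒰)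

/-- The observed history before epoch `n`: the sigma-algebra generated by the arms pulled at the
epochs `j < n` and by the outcomes of these arms. -/
abbrev history (I : ℕ → Ω → Fin K) (n : ℕ) : MeasurableSpace Ω :=
  ⨆ j : Fin n, MeasurableSpace.comap
    (fun ω => (I j ω, M.X j (I j ω) ω, M.R j (I j ω) ω, M.Y j (I j ω) ω)) inferInstance

/-- A sequence of arm pulls is a causal policy if each decision is determined by the seed and the
observed history. -/
def IsCausal (I : ℕ → Ω → Fin K) : Prop :=
  ∀ n k, MeasurableSet[MeasurableSpace.comap M.U inferInstance ⊔ M.history I n] {ω | I n ω = k}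

/-- Total cost of the first `n` pulls. -/
def cost (I : ℕ → Ω → Fin K) (n : ℕ) (ω : Ω) : ℝ :=
  ∑ i ∈ Finset.range n, M.X i (I i ω) ω

/-- Number of pulls until the total cost exceeds the budget `B`
(the value on the event that this never happens is immaterial, see the theorem). -/
noncomputable def pulls (I : ℕ → Ω → Fin K) (B : ℝ) (ω : Ω) : ℕ :=
  sInf {n : ℕ | 1 ≤ n ∧ B < M.cost I n ω}

/-- Cumulative reward, including that of the epoch in which the budget is depleted. -/
noncomputable def totalReward (I : ℕ → Ω → Fin K) (B : ℝ) (ω : Ω) : ℝ :=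
  ∑ i ∈ Finset.range (M.pulls I B ω), M.R i (I i ω) ω

/-- Cumulative penalty, including that of the epoch in which the budget is depleted. -/
noncomputable def totalPenalty (I : ℕ → Ω → Fin K) (B : ℝ) (ω : Ω) : ℝ :=
  ∑ i ∈ Finset.range (M.pulls I B ω), M.Y i (I i ω) ω

/-- The constraint-violation `D`. -/
noncomputable def violation (c : ℝ) (I : ℕ → Ω → Fin K) (B : ℝ) : ℝ :=
  (∫ ω, (1 / B) * M.totalPenalty I B ω ∂P) - c

/-- The causal policies that satisfy the penalty constraint for the budget `B`. -/
def feasible (c B : ℝ) : Set (ℕ → Ω → Fin K) :=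
  {I | M.IsCausal I ∧ ∫ ω, (1 / B) * M.totalPenalty I B ω ∂P ≤ c}

/-- The expected rewards of the feasible policies. -/
def feasibleValues (c B : ℝ) : Set ℝ :=
  (fun I : ℕ → Ω → Fin K => ∫ ω, M.totalReward I B ω ∂P) '' M.feasible c B

/-- Optimal expected reward over the feasible policies. -/
noncomputable def opt (c B : ℝ) : ℝ := sSup (M.feasibleValues c B)

/-- The (pseudo) regret. -/
noncomputable def regret (c : ℝ) (I : ℕ → Ω → Fin K) (B : ℝ) : ℝ :=
  M.opt c B - ∫ ω, M.totalReward I B ω ∂P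

/-- Reward rate of the probability vector `p`. -/
noncomputable def rewardRate (p : Fin K → ℝ) : ℝ :=
  (∑ k, p k * ∫ ω, M.R 0 k ω ∂P) / (∑ k, p k * ∫ ω, M.X 0 k ω ∂P)

/-- Penalty rate of the probability vector `p`. -/
noncomputable def penaltyRate (p : Fin K → ℝ) : ℝ :=
  (∑ k, p k * ∫ ω, M.Y 0 k ω ∂P) / (∑ k, p k * ∫ ω, M.X 0 k ω ∂P)

/-- `p` maximizes the reward rate over the probability simplex, subject to penalty rate `≤ c`. -/
def IsOptimalDistribution (c : ℝ) (p : Fin K → ℝ) : Prop :=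
  (p ∈ stdSimplex ℝ (Fin K) ∧ M.penaltyRate p ≤ c) ∧
    ∀ q ∈ stdSimplex ℝ (Fin K), M.penaltyRate q ≤ c → M.rewardRate q ≤ M.rewardRate p

/-- The stationary randomized policy with distribution `p`: the pulls are drawn from the seed
(hence independently of all outcomes), and are i.i.d. with distribution `p`. -/
structure IsStationaryRandomized (p : Fin K → ℝ) (I : ℕ → Ω → Fin K) : Prop where
  seed_measurable : ∀ n, Measurable[MeasurableSpace.comap M.U inferInstance] (I n)
  indep : iIndepFun I P
  law : ∀ n k, P.real {ω | I n ω = k} = p k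

end BanditModel

/-! Epoch `n` takes place exactly when the cost of the first `n` pulls is at most `B`, an event
determined by the seed and the earlier outcomes, hence independent of the outcomes of epoch `n`.
This gives Wald's identity (`integral_total`): each expected total is linear in the expected numbers
of pulls `T k`. As the last pull costs at most 1, the expected total cost lies in `(B, B + 1]`.

Upper bound: for a feasible policy, the normalized vector `T / ∑ T` has penalty rate at most `c`, so
the policy earns at most `r(p) (B + 1)` (`integral_totalReward_le_of_feasible`). The stationary
policy earns `r(p) S` and is penalized `y(p) S` with `S ∈ (B, B + 1]`
(`exists_integral_stationary`), which settles the violation and bounds the regret from above.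

The stationary policy may itself be infeasible, so the regret also needs a lower bound. Under the
Slater condition, starting with boundedly many pulls of the Slater arm makes it feasible at bounded
loss (`exists_feasible_of_slater`). Otherwise the existence of any feasible policy forces `c = 0`
and `y(p) = 0`, and the stationary policy is feasible (`mem_feasible_of_not_slater`). -/

/-- If `V` is independent of `(W, Z)` and `W` is independent of `Z`, then `(V, W)` is independent
of `Z`. -/
lemma ProbabilityTheory.IndepFun.prodMk_left_of_prodMk_right {Ω α β γ : Type*} [MeasurableSpace Ω]
    [MeasurableSpace α] [MeasurableSpace β] [MeasurableSpace γ] {P : Measure Ω}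
    [IsProbabilityMeasure P] {V : Ω → α} {W : Ω → β} {Z : Ω → γ} (hV : Measurable V)
    (hW : Measurable W) (hZ : Measurable Z) (h : IndepFun V (fun ω => (W ω, Z ω)) P)
    (h' : IndepFun W Z P) : IndepFun (fun ω => (V ω, W ω)) Z P := by
  have := Measure.isProbabilityMeasure_map (μ := P) hV.aemeasurable
  have := Measure.isProbabilityMeasure_map (μ := P) hW.aemeasurable
  have := Measure.isProbabilityMeasure_map (μ := P) hZ.aemeasurable
  have hVW : IndepFun V W P := h.comp measurable_id measurable_fst
  rw [indepFun_iff_map_prod_eq_prod_map_map (hV.prodMk hW).aemeasurable hZ.aemeasurable,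
    (indepFun_iff_map_prod_eq_prod_map_map hV.aemeasurable hW.aemeasurable).1 hVW]
  -- Up to reassociation, both sides are the product of the three marginal laws.
  apply (MeasurableEquiv.prodAssoc (α := α) (β := β) (γ := γ)).map_measurableEquiv_injective
  rw [Measure.prodAssoc_prod,
    ← (indepFun_iff_map_prod_eq_prod_map_map hW.aemeasurable hZ.aemeasurable).1 h',
    ← (indepFun_iff_map_prod_eq_prod_map_map hV.aemeasurable (hW.prodMk hZ).aemeasurable).1 h,
    Measure.map_map (MeasurableEquiv.measurable _) ((hV.prodMk hW).prodMk hZ)]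
  rfl

/-- Evaluating a countable family of measurable functions at a measurable index is measurable. -/
lemma measurable_apply_index {Ω κ E : Type*} {m : MeasurableSpace Ω} [MeasurableSpace κ]
    [Countable κ] [MeasurableSingletonClass κ] [MeasurableSpace E] {J : Ω → κ} {f : κ → Ω → E}
    (hJ : Measurable J) (hf : ∀ k, Measurable (f k)) : Measurable (fun ω => f (J ω) ω) := by
  have h : Measurable (fun q : Ω × κ => f q.2 q.1) :=
    measurable_from_prod_countable_left fun k => hf k
  exact h.comp (measurable_id.prodMk hJ)

/-- A pointwise sum of integrable functions is integrable, and may be integrated termwise, if the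
integrals of the norms are summable. -/
lemma integrable_and_hasSum_integral_of_hasSum {Ω : Type*} [MeasurableSpace Ω] {P : Measure Ω}
    {F : ℕ → Ω → ℝ} {f : Ω → ℝ} (hF : ∀ n, Integrable (F n) P)
    (hs : Summable fun n => ∫ ω, ‖F n ω‖ ∂P) (hf : ∀ᵐ ω ∂P, HasSum (fun n => F n ω) (f ω)) :
    Integrable f P ∧ HasSum (fun n => ∫ ω, F n ω ∂P) (∫ ω, f ω ∂P) := by
  have heq : f =ᵐ[P] fun ω => ∑' n, F n ω := by
    filter_upwards [hf] with ω hω using hω.tsum_eq.symm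
  refine ⟨⟨?_, ?_⟩, ?_⟩
  · refine aestronglyMeasurable_of_tendsto_ae (u := atTop)
      (f := fun n ω => ∑ i ∈ Finset.range n, F i ω)
      (fun n => (integrable_finsetSum _ fun i _ => hF i).1) ?_
    filter_upwards [hf] with ω hω using hω.tendsto_sum_nat
  · have h1 : ∫⁻ ω, ‖f ω‖ₑ ∂P ≤ ∫⁻ ω, ∑' n, ‖F n ω‖ₑ ∂P := by
      refine lintegral_mono_ae ?_
      filter_upwards [heq] with ω hω
      rw [hω]
      exact enorm_tsum_le_tsum_enorm
    refine lt_of_le_of_lt h1 ?_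
    rw [lintegral_tsum fun n => (hF n).1.enorm]
    have h2 : ∀ n, ∫⁻ ω, ‖F n ω‖ₑ ∂P = ENNReal.ofReal (∫ ω, ‖F n ω‖ ∂P) := fun n => by
      rw [ofReal_integral_norm_eq_lintegral_enorm (hF n)]
    simp_rw [h2]
    exact hs.tsum_ofReal_lt_top
  · rw [integral_congr_ae heq]
    exact hasSum_integral_of_summable_integral_norm hF hs

namespace BanditModel

variable {K : ℕ} {Ω : Type*} [MeasurableSpace Ω] {P : Measure Ω}
  {𝒰 : Type*} [MeasurableSpace 𝒰] (M : BanditModel K P 𝒰)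

/-! ### The past and its independence of the current outcomes -/

/-- The outcome triple of arm `k` at epoch `n`. -/
def outcome (n : ℕ) (k : Fin K) (ω : Ω) : ℝ × ℝ × ℝ := (M.X n k ω, M.R n k ω, M.Y n k ω)

lemma measurable_outcome (n : ℕ) (k : Fin K) : Measurable (M.outcome n k) :=
  (M.measurable_X n k).prodMk ((M.measurable_R n k).prodMk (M.measurable_Y n k))

/-- The indices of all outcomes of the epochs before `n`. -/
abbrev pastIndices (K n : ℕ) : Finset (ℕ × Fin K) := Finset.range n ×ˢ Finset.univ

/-- The seed together with all outcomes, observed or not, of the epochs before `n`. -/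
def past (n : ℕ) (ω : Ω) : 𝒰 × (pastIndices K n → ℝ × ℝ × ℝ) :=
  (M.U ω, fun i => M.outcome i.1.1 i.1.2 ω)

lemma measurable_past (n : ℕ) : Measurable (M.past n) :=
  M.measurable_U.prodMk (measurable_pi_lambda _ fun i => M.measurable_outcome i.1.1 i.1.2)

lemma indepFun_past_outcome [IsProbabilityMeasure P] (n : ℕ) (k : Fin K) :
    IndepFun (M.past n) (M.outcome n k) P := by
  have hmeas : ∀ i : ℕ × Fin K, Measurable (fun ω => (M.X i.1 i.2 ω, M.R i.1 i.2 ω, M.Y i.1 i.2 ω)) :=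
    fun i => M.measurable_outcome i.1 i.2
  refine IndepFun.prodMk_left_of_prodMk_right M.measurable_U
    (measurable_pi_lambda _ fun i => M.measurable_outcome i.1.1 i.1.2)
    (M.measurable_outcome n k) ?_ ?_
  · have hφ : Measurable (fun a : ℕ → Fin K → ℝ × ℝ × ℝ =>
        ((fun i : pastIndices K n => a i.1.1 i.1.2), a n k)) :=
      (measurable_pi_lambda _ fun i => (measurable_pi_apply i.1.2).comp
        (measurable_pi_apply i.1.1)).prodMk
        ((measurable_pi_apply k).comp (measurable_pi_apply n))
    exact M.indep_seed.comp measurable_id hφ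
  · have hd : Disjoint (pastIndices K n) {(n, k)} := by simp
    have h := M.indep.indepFun_finset _ _ hd hmeas
    exact h.comp measurable_id
      (measurable_pi_apply (⟨(n, k), Finset.mem_singleton_self _⟩ : ({(n, k)} : Finset (ℕ × Fin K))))

/-- The sigma-algebra generated by the seed and all outcomes of the epochs before `n`. -/
abbrev pastSigma (n : ℕ) : MeasurableSpace Ω := MeasurableSpace.comap (M.past n) inferInstance

lemma measurable_pastSigma_U (n : ℕ) : Measurable[M.pastSigma n] M.U :=
  measurable_fst.comp (comap_measurable (M.past n))

lemma measurable_pastSigma_outcome {n j : ℕ} (hj : j < n) (k : Fin K) :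
    Measurable[M.pastSigma n] (M.outcome j k) :=
  ((measurable_pi_apply (⟨(j, k), by simpa using hj⟩ : pastIndices K n)).comp
    measurable_snd).comp (comap_measurable (M.past n))

lemma pastSigma_mono {m n : ℕ} (h : m ≤ n) : M.pastSigma m ≤ M.pastSigma n := by
  rw [← measurable_iff_comap_le]
  refine (M.measurable_pastSigma_U n).prodMk (@measurable_pi_lambda _ _ _ (M.pastSigma n) _ _ ?_)
  intro i
  have hi : i.1.1 < m := Finset.mem_range.1 (Finset.mem_product.1 i.2).1
  exact M.measurable_pastSigma_outcome (hi.trans_le h) _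

lemma pastSigma_le (n : ℕ) : M.pastSigma n ≤ ‹MeasurableSpace Ω› :=
  (M.measurable_past n).comap_le

variable {M}

/-- The observed history involves outcomes at random arm indices, so its measurability rests on that
of the earlier pulls; hence the strong induction. -/
lemma IsCausal.measurable_pastSigma {J : ℕ → Ω → Fin K} (hJ : M.IsCausal J) (n : ℕ) :
    Measurable[M.pastSigma n] (J n) := by
  induction n using Nat.strong_induction_on with
  | _ n ih =>
    have hle : MeasurableSpace.comap M.U inferInstance ⊔ M.history J n ≤ M.pastSigma n := by
      refine sup_le (measurable_iff_comap_le.1 (M.measurable_pastSigma_U n)) (iSup_le fun j => ?_)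
      rw [← measurable_iff_comap_le]
      have hj := (ih j j.2).mono (M.pastSigma_mono j.2.le) le_rfl
      exact hj.prodMk (measurable_apply_index hj fun k => M.measurable_pastSigma_outcome j.2 k)
    exact @measurable_to_countable' _ _ _ _ (M.pastSigma n) _ fun k => hle _ (hJ n k)

lemma measurable_pastSigma_cost {J : ℕ → Ω → Fin K} (hJ : M.IsCausal J) (n : ℕ) :
    Measurable[M.pastSigma n] (M.cost J n) := by
  unfold cost
  refine Finset.measurable_sum _ fun i hi => ?_
  have hi' := Finset.mem_range.1 hi
  exact measurable_fst.comp (measurable_apply_index (f := fun k => M.outcome i k)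
    ((hJ.measurable_pastSigma i).mono (M.pastSigma_mono hi'.le) le_rfl)
    fun k => M.measurable_pastSigma_outcome hi' k)

/-! ### The cost process and the depletion of the budget -/

variable (M) in
lemma cost_mono (J : ℕ → Ω → Fin K) (ω : Ω) : Monotone fun n => M.cost J n ω :=
  monotone_nat_of_le_succ fun n => by
    simp only [cost, Finset.sum_range_succ]
    linarith [(M.X_mem n (J n ω) ω).1]

variable (M) in
lemma cost_le (J : ℕ → Ω → Fin K) (n : ℕ) (ω : Ω) : M.cost J n ω ≤ n := by
  calc M.cost J n ω ≤ ∑ i ∈ Finset.range n, (1 : ℝ) :=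
        Finset.sum_le_sum fun i _ => (M.X_mem i (J i ω) ω).2
    _ = n := by simp

variable (M) in
/-- The event that the budget is not exceeded by the first `n` pulls, so that epoch `n` takes
place. -/
def active (J : ℕ → Ω → Fin K) (B : ℝ) (n : ℕ) : Set Ω := {ω | M.cost J n ω ≤ B}

lemma measurableSet_active {J : ℕ → Ω → Fin K} (hJ : M.IsCausal J) (B : ℝ) (n : ℕ) :
    MeasurableSet[M.pastSigma n] (M.active J B n) :=
  measurableSet_le (measurable_pastSigma_cost hJ n) measurable_const

lemma active_eq_univ (J : ℕ → Ω → Fin K) {B : ℝ} {n : ℕ} (h : (n : ℝ) ≤ B) :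
    M.active J B n = Set.univ :=
  Set.eq_univ_of_forall fun ω => (M.cost_le J n ω).trans h

/-- Costs are monotone, so once the budget is exceeded it stays exceeded. This turns sums of random
length into series of indicators. -/
lemma lt_pulls_iff {J : ℕ → Ω → Fin K} {B : ℝ} (hB : 0 < B) {ω : Ω} (h : ∃ n, B < M.cost J n ω)
    (n : ℕ) : n < M.pulls J B ω ↔ ω ∈ M.active J B n := by
  -- Since `B > 0`, the condition `1 ≤ n` in `pulls` is automatic.
  have hpos : ∀ j, B < M.cost J j ω → 1 ≤ j := fun j hj => by
    by_contra! h0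
    interval_cases j
    simp only [cost, Finset.range_zero, Finset.sum_empty] at hj
    linarith
  obtain ⟨N, hN⟩ := h
  have hmem : M.pulls J B ω ∈ {n : ℕ | 1 ≤ n ∧ B < M.cost J n ω} :=
    Nat.sInf_mem ⟨N, hpos N hN, hN⟩
  constructor
  · intro hn
    by_contra hc
    have hc' : B < M.cost J n ω := not_le.1 hc
    exact absurd (Nat.sInf_le ⟨hpos n hc', hc'⟩ : M.pulls J B ω ≤ n) (not_le.2 hn)
  · intro hn
    by_contra hc
    exact absurd (hmem.2.trans_le (M.cost_mono J ω (not_lt.1 hc))) (not_lt.2 hn)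

/-- The cost of the active epochs exceeds the budget by at most `1`. -/
lemma sum_active_cost_le {J : ℕ → Ω → Fin K} {B : ℝ} (hB : 0 < B) (ω : Ω) (n : ℕ) :
    ∑ i ∈ Finset.range n, (M.active J B i).indicator (fun ω => M.X i (J i ω) ω) ω ≤ B + 1 := by
  -- The second bound closes the induction: at an active epoch the sum so far is at most the cost,
  -- hence at most `B`, and the pull adds at most 1.
  suffices h : ∑ i ∈ Finset.range n, (M.active J B i).indicator (fun ω => M.X i (J i ω) ω) ω
      ≤ B + 1 ∧ ∑ i ∈ Finset.range n, (M.active J B i).indicator (fun ω => M.X i (J i ω) ω) ω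
      ≤ M.cost J n ω from h.1
  induction n with
  | zero => simp [cost]; linarith
  | succ n ih =>
    have hx := M.X_mem n (J n ω) ω
    rw [Finset.sum_range_succ, cost, Finset.sum_range_succ, ← cost]
    by_cases h : ω ∈ M.active J B n
    · rw [Set.indicator_of_mem h]
      have : M.cost J n ω ≤ B := h
      constructor <;> linarith [ih.1, ih.2, hx.1, hx.2]
    · rw [Set.indicator_of_notMem h]
      constructor <;> linarith [ih.1, ih.2, hx.1, hx.2]

/-! ### Expected payoff of a single epoch -/

lemma measurable_pull {J : ℕ → Ω → Fin K} (hJ : M.IsCausal J) (n : ℕ) : Measurable (J n) :=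
  (hJ.measurable_pastSigma n).mono (M.pastSigma_le n) le_rfl

lemma measurable_payoff {J : ℕ → Ω → Fin K} (hJ : M.IsCausal J) {g : ℝ × ℝ × ℝ → ℝ}
    (hg : Measurable g) (n : ℕ) : Measurable fun ω => g (M.outcome n (J n ω) ω) :=
  hg.comp (measurable_apply_index (f := fun k => M.outcome n k) (measurable_pull hJ n)
    fun k => M.measurable_outcome n k)

lemma measurableSet_active_inter {J : ℕ → Ω → Fin K} (hJ : M.IsCausal J) (B : ℝ) (n : ℕ)
    (k : Fin K) : MeasurableSet[M.pastSigma n] (M.active J B n ∩ {ω | J n ω = k}) :=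
  (measurableSet_active hJ B n).inter
    (hJ.measurable_pastSigma n (measurableSet_singleton k))

/-- The payoff of arm `k` at epoch `n` is independent of the events determined by the past. -/
lemma integral_indicator_outcome [IsProbabilityMeasure P] {g : ℝ × ℝ × ℝ → ℝ}
    (hg : Measurable g) {n : ℕ} {E : Set Ω} (hE : MeasurableSet[M.pastSigma n] E) (k : Fin K) :
    ∫ ω, E.indicator (fun ω => g (M.outcome n k ω)) ω ∂P =
      P.real E * ∫ ω, g (M.outcome 0 k ω) ∂P := by
  have hEm : MeasurableSet E := M.pastSigma_le n _ hE
  obtain ⟨E', hE', rfl⟩ := hE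
  have hind : IndepFun (fun ω => E'.indicator (fun _ => (1 : ℝ)) (M.past n ω))
      (fun ω => g (M.outcome n k ω)) P :=
    (M.indepFun_past_outcome n k).comp (measurable_const.indicator hE') hg
  have h1 : ∀ ω, (M.past n ⁻¹' E').indicator (fun ω => g (M.outcome n k ω)) ω =
      E'.indicator (fun _ => (1 : ℝ)) (M.past n ω) * g (M.outcome n k ω) := fun ω => by
    by_cases h : M.past n ω ∈ E'
    · rw [Set.indicator_of_mem h, Set.indicator_of_mem (show ω ∈ M.past n ⁻¹' E' from h), one_mul]
    · rw [Set.indicator_of_notMem h, Set.indicator_of_notMem (show ω ∉ M.past n ⁻¹' E' from h),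
        zero_mul]
  simp_rw [h1]
  rw [hind.integral_fun_mul_eq_mul_integral
    ((measurable_const.indicator hE').comp (M.measurable_past n)).aestronglyMeasurable
    (hg.comp (M.measurable_outcome n k)).aestronglyMeasurable]
  congr 1
  · have h2 : (fun ω => E'.indicator (fun _ => (1 : ℝ)) (M.past n ω)) =
        (M.past n ⁻¹' E').indicator 1 := rfl
    rw [h2, integral_indicator_one hEm]
  · exact ((M.ident n k).comp hg).integral_eq

lemma integrable_indicator_payoff [IsProbabilityMeasure P] {J : ℕ → Ω → Fin K}
    (hJ : M.IsCausal J) {g : ℝ × ℝ × ℝ → ℝ} (hg : Measurable g)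
    (hg01 : ∀ n k ω, g (M.outcome n k ω) ∈ Set.Icc (0 : ℝ) 1) (n : ℕ) {E : Set Ω}
    (hE : MeasurableSet E) : Integrable (E.indicator fun ω => g (M.outcome n (J n ω) ω)) P := by
  refine Integrable.indicator ?_ hE
  refine Integrable.of_bound (measurable_payoff hJ hg n).aestronglyMeasurable 1 (ae_of_all _ ?_)
  intro ω
  rw [Real.norm_eq_abs, abs_of_nonneg (hg01 n _ ω).1]
  exact (hg01 n _ ω).2

/-- Splitting by the pulled arm replaces the random index by a fixed one on an event of the past, to
which independence applies. -/
lemma integral_active_payoff [IsProbabilityMeasure P] {J : ℕ → Ω → Fin K} (hJ : M.IsCausal J)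
    {g : ℝ × ℝ × ℝ → ℝ} (hg : Measurable g)
    (hg01 : ∀ n k ω, g (M.outcome n k ω) ∈ Set.Icc (0 : ℝ) 1) (B : ℝ) (n : ℕ) :
    ∫ ω, (M.active J B n).indicator (fun ω => g (M.outcome n (J n ω) ω)) ω ∂P =
      ∑ k, P.real (M.active J B n ∩ {ω | J n ω = k}) * ∫ ω, g (M.outcome 0 k ω) ∂P := by
  have hsplit : ∀ ω, (M.active J B n).indicator (fun ω => g (M.outcome n (J n ω) ω)) ω =
      ∑ k, (M.active J B n ∩ {ω | J n ω = k}).indicator (fun ω => g (M.outcome n k ω)) ω := by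
    intro ω
    rw [Finset.sum_eq_single (J n ω)]
    · by_cases h : ω ∈ M.active J B n
      · rw [Set.indicator_of_mem h, Set.indicator_of_mem
          (show ω ∈ M.active J B n ∩ {ω' | J n ω' = J n ω} from ⟨h, rfl⟩)]
      · rw [Set.indicator_of_notMem h, Set.indicator_of_notMem fun h' => h h'.1]
    · exact fun k _ hk => Set.indicator_of_notMem (fun h => hk h.2.symm) _
    · simp
  simp_rw [hsplit]
  rw [integral_finsetSum]
  · exact Finset.sum_congr rfl fun k _ =>
      integral_indicator_outcome hg (measurableSet_active_inter hJ B n k) k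
  · intro k _
    refine Integrable.indicator ?_ (M.pastSigma_le n _ (measurableSet_active_inter hJ B n k))
    refine Integrable.of_bound (hg.comp (M.measurable_outcome n k)).aestronglyMeasurable 1
      (ae_of_all _ fun ω => ?_)
    rw [Real.norm_eq_abs, abs_of_nonneg (hg01 n _ ω).1]
    exact (hg01 n _ ω).2

lemma sum_real_active_inter [IsProbabilityMeasure P] {J : ℕ → Ω → Fin K} (hJ : M.IsCausal J)
    (B : ℝ) (n : ℕ) :
    ∑ k, P.real (M.active J B n ∩ {ω | J n ω = k}) = P.real (M.active J B n) := by
  have h := integral_active_payoff hJ (g := fun _ => 1) measurable_const (by simp) B n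
  have hm := M.pastSigma_le n _ (measurableSet_active hJ B n)
  have h2 : (M.active J B n).indicator (fun _ => (1 : ℝ)) = (M.active J B n).indicator 1 := rfl
  rw [h2, integral_indicator_one hm] at h
  simpa using h.symm

/-! ### Finiteness of the expected number of pulls -/

lemma exists_pos_le_integral_X (hX : ∀ k, 0 < ∫ ω, M.X 0 k ω ∂P) :
    ∃ δ : ℝ, 0 < δ ∧ ∀ k, δ ≤ ∫ ω, M.X 0 k ω ∂P := by
  rcases isEmpty_or_nonempty (Fin K) with h | h
  · exact ⟨1, one_pos, fun k => h.elim k⟩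
  · obtain ⟨k, hk⟩ := Finite.exists_min fun k => ∫ ω, M.X 0 k ω ∂P
    exact ⟨_, hX k, hk⟩

/-- Each active epoch costs at least `δ` in conditional expectation, while all active epochs
together cost at most `B + 1`. -/
lemma summable_real_active [IsProbabilityMeasure P] (hX : ∀ k, 0 < ∫ ω, M.X 0 k ω ∂P)
    {J : ℕ → Ω → Fin K} (hJ : M.IsCausal J) {B : ℝ} (hB : 0 < B) :
    Summable fun n => P.real (M.active J B n) := by
  obtain ⟨δ, hδ, hδX⟩ := exists_pos_le_integral_X hX
  refine summable_of_sum_range_le (c := (B + 1) / δ) (fun n => measureReal_nonneg) fun n => ?_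
  rw [le_div_iff₀ hδ, Finset.sum_mul]
  have hint : ∀ i, Integrable ((M.active J B i).indicator fun ω => M.X i (J i ω) ω) P := fun i =>
    integrable_indicator_payoff hJ measurable_fst (fun n k ω => M.X_mem n k ω) i
      (M.pastSigma_le i _ (measurableSet_active hJ B i))
  calc ∑ i ∈ Finset.range n, P.real (M.active J B i) * δ
      ≤ ∑ i ∈ Finset.range n,
          ∫ ω, (M.active J B i).indicator (fun ω => M.X i (J i ω) ω) ω ∂P := by
        refine Finset.sum_le_sum fun i _ => ?_
        refine le_of_le_of_eq ?_ (integral_active_payoff hJ measurable_fst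
          (fun n k ω => M.X_mem n k ω) B i).symm
        rw [← sum_real_active_inter hJ, Finset.sum_mul]
        exact Finset.sum_le_sum fun k _ =>
          mul_le_mul_of_nonneg_left (hδX k) measureReal_nonneg
    _ = ∫ ω, ∑ i ∈ Finset.range n,
          (M.active J B i).indicator (fun ω => M.X i (J i ω) ω) ω ∂P :=
        (integral_finsetSum _ fun i _ => hint i).symm
    _ ≤ ∫ _, (B + 1) ∂P := by
        refine integral_mono (integrable_finsetSum _ fun i _ => hint i) (integrable_const _) ?_
        exact fun ω => sum_active_cost_le hB ω n
    _ = B + 1 := by simp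

/-- The event of never depleting the budget lies in every active event, and the probabilities of
these tend to 0. -/
lemma ae_exists_lt_cost [IsProbabilityMeasure P] (hX : ∀ k, 0 < ∫ ω, M.X 0 k ω ∂P)
    {J : ℕ → Ω → Fin K} (hJ : M.IsCausal J) {B : ℝ} (hB : 0 < B) :
    ∀ᵐ ω ∂P, ∃ n, B < M.cost J n ω := by
  have ht := (summable_real_active hX hJ hB).tendsto_atTop_zero
  have h0 : P.real {ω | ¬ ∃ n, B < M.cost J n ω} ≤ 0 := by
    refine ge_of_tendsto' ht fun n => measureReal_mono fun ω hω => ?_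
    exact not_lt.1 fun h => hω ⟨n, h⟩
  rw [ae_iff]
  exact (measureReal_eq_zero_iff).1 (le_antisymm h0 measureReal_nonneg)

/-! ### Wald's identity and the expected total cost -/

variable (M) in
/-- Cumulative payoff `g` of the pulls, including that of the epoch in which the budget is
depleted. -/
noncomputable def total (g : ℝ × ℝ × ℝ → ℝ) (J : ℕ → Ω → Fin K) (B : ℝ) (ω : Ω) : ℝ :=
  ∑ i ∈ Finset.range (M.pulls J B ω), g (M.outcome i (J i ω) ω)

variable (M) in
/-- Expected number of pulls of arm `k`. -/
noncomputable def expectedPulls (J : ℕ → Ω → Fin K) (B : ℝ) (k : Fin K) : ℝ :=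
  ∑' n, P.real (M.active J B n ∩ {ω | J n ω = k})

lemma integrable_total_and_hasSum [IsProbabilityMeasure P] (hX : ∀ k, 0 < ∫ ω, M.X 0 k ω ∂P)
    {J : ℕ → Ω → Fin K} (hJ : M.IsCausal J) {B : ℝ} (hB : 0 < B) {g : ℝ × ℝ × ℝ → ℝ}
    (hg : Measurable g) (hg01 : ∀ n k ω, g (M.outcome n k ω) ∈ Set.Icc (0 : ℝ) 1) :
    Integrable (M.total g J B) P ∧
      HasSum (fun n => ∑ k, P.real (M.active J B n ∩ {ω | J n ω = k}) *
        ∫ ω, g (M.outcome 0 k ω) ∂P) (∫ ω, M.total g J B ω ∂P) := by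
  have hm := fun n => M.pastSigma_le n _ (measurableSet_active hJ B n)
  simp_rw [← integral_active_payoff hJ hg hg01 B]
  refine integrable_and_hasSum_integral_of_hasSum
    (fun n => integrable_indicator_payoff hJ hg hg01 n (hm n)) ?_ ?_
  · refine (summable_real_active hX hJ hB).of_nonneg_of_le
      (fun n => integral_nonneg fun ω => norm_nonneg _) fun n => ?_
    rw [← integral_indicator_one (hm n)]
    refine integral_mono (integrable_indicator_payoff hJ hg hg01 n (hm n)).norm
      ((integrable_const (1 : ℝ)).indicator (hm n)) fun ω => ?_
    by_cases h : ω ∈ M.active J B n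
    · simp only [Set.indicator_of_mem h, Real.norm_eq_abs, Pi.one_apply]
      rw [abs_of_nonneg (hg01 n _ ω).1]
      exact (hg01 n _ ω).2
    · simp [Set.indicator_of_notMem h]
  · filter_upwards [ae_exists_lt_cost hX hJ hB] with ω hω
    have hsum : M.total g J B ω = ∑ i ∈ Finset.range (M.pulls J B ω),
        (M.active J B i).indicator (fun ω => g (M.outcome i (J i ω) ω)) ω :=
      Finset.sum_congr rfl fun i hi => by
        rw [Set.indicator_of_mem ((lt_pulls_iff hB hω i).1 (Finset.mem_range.1 hi))]
    rw [hsum]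
    refine hasSum_sum_of_ne_finset_zero fun i hi => Set.indicator_of_notMem (fun h => hi ?_) _
    exact Finset.mem_range.2 ((lt_pulls_iff hB hω i).2 h)

lemma summable_real_active_inter [IsProbabilityMeasure P] (hX : ∀ k, 0 < ∫ ω, M.X 0 k ω ∂P)
    {J : ℕ → Ω → Fin K} (hJ : M.IsCausal J) {B : ℝ} (hB : 0 < B) (k : Fin K) :
    Summable fun n => P.real (M.active J B n ∩ {ω | J n ω = k}) :=
  (summable_real_active hX hJ hB).of_nonneg_of_le (fun _ => measureReal_nonneg)
    fun _ => measureReal_mono Set.inter_subset_left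

/-- **Wald's identity**: the expected cumulative payoff is determined by the expected numbers of
pulls. -/
lemma integral_total [IsProbabilityMeasure P] (hX : ∀ k, 0 < ∫ ω, M.X 0 k ω ∂P)
    {J : ℕ → Ω → Fin K} (hJ : M.IsCausal J) {B : ℝ} (hB : 0 < B) {g : ℝ × ℝ × ℝ → ℝ}
    (hg : Measurable g) (hg01 : ∀ n k ω, g (M.outcome n k ω) ∈ Set.Icc (0 : ℝ) 1) :
    ∫ ω, M.total g J B ω ∂P = ∑ k, M.expectedPulls J B k * ∫ ω, g (M.outcome 0 k ω) ∂P := by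
  refine (integrable_total_and_hasSum hX hJ hB hg hg01).2.unique ?_
  exact hasSum_sum fun k _ => (summable_real_active_inter hX hJ hB k).hasSum.mul_right _

lemma total_cost_mem [IsProbabilityMeasure P] (hX : ∀ k, 0 < ∫ ω, M.X 0 k ω ∂P)
    {J : ℕ → Ω → Fin K} (hJ : M.IsCausal J) {B : ℝ} (hB : 0 < B) :
    ∀ᵐ ω ∂P, M.total Prod.fst J B ω ∈ Set.Ioc B (B + 1) := by
  filter_upwards [ae_exists_lt_cost hX hJ hB] with ω hω
  constructor
  · have h := mt (lt_pulls_iff hB hω (M.pulls J B ω)).2 (lt_irrefl _)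
    exact not_le.1 h
  · refine le_of_eq_of_le (Finset.sum_congr rfl fun i hi => ?_)
      (sum_active_cost_le (M := M) (J := J) hB ω (M.pulls J B ω))
    rw [Set.indicator_of_mem ((lt_pulls_iff hB hω i).1 (Finset.mem_range.1 hi))]
    rfl

lemma integral_total_cost_mem [IsProbabilityMeasure P] (hX : ∀ k, 0 < ∫ ω, M.X 0 k ω ∂P)
    {J : ℕ → Ω → Fin K} (hJ : M.IsCausal J) {B : ℝ} (hB : 0 < B) :
    ∫ ω, M.total Prod.fst J B ω ∂P ∈ Set.Ioc B (B + 1) := by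
  have hint := (integrable_total_and_hasSum hX hJ hB measurable_fst
    fun n k ω => M.X_mem n k ω).1
  have hae := total_cost_mem hX hJ hB
  constructor
  · have h0 : 0 ≤ᵐ[P] fun ω => M.total Prod.fst J B ω - B := by
      filter_upwards [hae] with ω hω using sub_nonneg.2 hω.1.le
    -- The lower bound is strict because the overshoot is almost surely positive.
    have h1 : 0 < ∫ ω, (M.total Prod.fst J B ω - B) ∂P := by
      rw [integral_pos_iff_support_of_nonneg_ae h0 (hint.sub (integrable_const _))]
      have h2 : (Function.support fun ω => M.total Prod.fst J B ω - B) =ᵐ[P] Set.univ := by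
        rw [eventuallyEq_univ]
        filter_upwards [hae] with ω hω using (sub_pos.2 hω.1).ne'
      rw [measure_congr h2, measure_univ]
      exact one_pos
    rw [integral_sub hint (integrable_const _)] at h1
    simpa using h1
  · calc ∫ ω, M.total Prod.fst J B ω ∂P ≤ ∫ _, (B + 1) ∂P := by
          refine integral_mono_ae hint (integrable_const _) ?_
          filter_upwards [hae] with ω hω using hω.2
      _ = B + 1 := by simp

lemma expectedPulls_nonneg (J : ℕ → Ω → Fin K) (B : ℝ) (k : Fin K) :
    0 ≤ M.expectedPulls J B k := tsum_nonneg fun _ => measureReal_nonneg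

/-! ### Stationary policies preceded by pulls of a fixed arm -/

lemma isCausal_of_measurable_seed {J : ℕ → Ω → Fin K}
    (hJ : ∀ n, Measurable[MeasurableSpace.comap M.U inferInstance] (J n)) : M.IsCausal J :=
  fun n k => (le_sup_left : _ ≤ MeasurableSpace.comap M.U inferInstance ⊔ M.history J n) _
    (hJ n (measurableSet_singleton k))

/-- Pull the arm `k₀` at the epochs before `m`, and follow `I` afterwards. -/
def delayed (m : ℕ) (k₀ : Fin K) (I : ℕ → Ω → Fin K) (n : ℕ) (ω : Ω) : Fin K :=
  if n < m then k₀ else I n ω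

lemma delayed_zero {Ω : Type*} (k₀ : Fin K) (I : ℕ → Ω → Fin K) : delayed 0 k₀ I = I := by
  ext n ω
  simp [delayed]

lemma isCausal_delayed {p : Fin K → ℝ} {I : ℕ → Ω → Fin K} (hI : M.IsStationaryRandomized p I)
    (m : ℕ) (k₀ : Fin K) : M.IsCausal (delayed m k₀ I) := by
  refine isCausal_of_measurable_seed fun n => ?_
  by_cases h : n < m
  · have : delayed m k₀ I n = fun _ => k₀ := by ext; simp [delayed, h]
    rw [this]
    exact measurable_const
  · have : delayed m k₀ I n = I n := by ext; simp [delayed, h]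
    rw [this]
    exact hI.seed_measurable n

/-- A pull of a stationary randomized policy is independent of all outcomes together with the
pulls before. -/
lemma IsStationaryRandomized.indepFun_outcomes_pull [IsProbabilityMeasure P] {p : Fin K → ℝ}
    {I : ℕ → Ω → Fin K} (hI : M.IsStationaryRandomized p I) (n : ℕ) :
    IndepFun (fun ω => ((fun j k => M.outcome j k ω), fun i : Finset.range n => I i ω)) (I n) P := by
  have hmeas : ∀ j, Measurable (I j) := fun j =>
    (hI.seed_measurable j).mono M.measurable_U.comap_le le_rfl
  refine IndepFun.prodMk_left_of_prodMk_right
    (measurable_pi_lambda _ fun j => measurable_pi_lambda _ fun k => M.measurable_outcome j k)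
    (measurable_pi_lambda _ fun i => hmeas i) (hmeas n) ?_ ?_
  · have hs : Measurable[MeasurableSpace.comap M.U inferInstance]
        (fun ω => ((fun i : Finset.range n => I i ω), I n ω)) :=
      Measurable.prodMk (@measurable_pi_lambda _ _ _ (MeasurableSpace.comap M.U inferInstance) _ _
        fun i => hI.seed_measurable i) (hI.seed_measurable n)
    have h : IndepFun (fun ω => ((fun i : Finset.range n => I i ω), I n ω))
        (fun ω j k => M.outcome j k ω) P := by
      have h0 := M.indep_seed
      rw [IndepFun_iff_Indep] at h0 ⊢
      exact indep_of_indep_of_le_left h0 hs.comap_le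
    exact h.symm
  · have hd : Disjoint (Finset.range n) {n} := by simp
    exact (hI.indep.indepFun_finset _ _ hd hmeas).comp measurable_id
      (measurable_pi_apply (⟨n, Finset.mem_singleton_self _⟩ : ({n} : Finset ℕ)))

/-- From epoch `m` on, the pull is independent of whether the epoch is active. `pastSigma` cannot
serve here, as it contains the seed and hence the pull itself; the sigma-algebra of all outcomes and
the earlier pulls of `I` replaces it. -/
lemma real_active_inter_delayed [IsProbabilityMeasure P] {p : Fin K → ℝ}
    {I : ℕ → Ω → Fin K} (hI : M.IsStationaryRandomized p I) {m n : ℕ} (hmn : m ≤ n) (k₀ : Fin K)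
    (B : ℝ) (k : Fin K) :
    P.real (M.active (delayed m k₀ I) B n ∩ {ω | delayed m k₀ I n ω = k}) =
      P.real (M.active (delayed m k₀ I) B n) * p k := by
  have hn : {ω | delayed m k₀ I n ω = k} = I n ⁻¹' {k} := by
    ext ω; simp [delayed, hmn.not_gt]
  rw [hn, ← hI.law n k]
  set D : Ω → (ℕ → Fin K → ℝ × ℝ × ℝ) × (Finset.range n → Fin K) :=
    fun ω => ((fun j k => M.outcome j k ω), fun i : Finset.range n => I i ω) with hD
  have hDm : Measurable[MeasurableSpace.comap D inferInstance] D := comap_measurable D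
  have hA : MeasurableSet[MeasurableSpace.comap D inferInstance]
      (M.active (delayed m k₀ I) B n) := by
    refine measurableSet_le ?_ measurable_const
    unfold cost
    refine Finset.measurable_sum _ fun i hi => ?_
    refine measurable_fst.comp (measurable_apply_index (f := fun k => M.outcome i k) ?_ fun k => ?_)
    · by_cases h : i < m
      · have : delayed m k₀ I i = fun _ => k₀ := by ext; simp [delayed, h]
        rw [this]
        exact measurable_const
      · have : delayed m k₀ I i = I i := by ext; simp [delayed, h]
        rw [this]
        exact ((measurable_pi_apply (⟨i, hi⟩ : Finset.range n)).comp measurable_snd).comp hDm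
    · exact (((measurable_pi_apply k).comp (measurable_pi_apply i)).comp measurable_fst).comp hDm
  have h := (IndepFun_iff_Indep _ _ _).1 (hI.indepFun_outcomes_pull n)
  have h2 := (Indep_iff _ _ _).1 h _ _ hA ⟨{k}, measurableSet_singleton k, rfl⟩
  simp only [Measure.real, h2, ENNReal.toReal_mul]
  rfl

/-- The expected cumulative payoff of a delayed stationary randomized policy, in terms of the
expected number `A` of pulls. -/
lemma exists_integral_total_delayed [IsProbabilityMeasure P]
    (hX : ∀ k, 0 < ∫ ω, M.X 0 k ω ∂P) {p : Fin K → ℝ} {I : ℕ → Ω → Fin K}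
    (hI : M.IsStationaryRandomized p I) {m : ℕ} (k₀ : Fin K) {B : ℝ} (hB : 0 < B)
    (hm : (m : ℝ) ≤ B) :
    ∃ A : ℝ, ∀ g : ℝ × ℝ × ℝ → ℝ, Measurable g →
      (∀ n k ω, g (M.outcome n k ω) ∈ Set.Icc (0 : ℝ) 1) →
      ∫ ω, M.total g (delayed m k₀ I) B ω ∂P =
        m * ∫ ω, g (M.outcome 0 k₀ ω) ∂P +
          (A - m) * ∑ k, p k * ∫ ω, g (M.outcome 0 k ω) ∂P := by
  have hJ := isCausal_delayed hI m k₀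
  refine ⟨∑' n, P.real (M.active (delayed m k₀ I) B n), fun g hg hg01 => ?_⟩
  refine (integrable_total_and_hasSum hX hJ hB hg hg01).2.unique ?_
  set z := fun k => ∫ ω, g (M.outcome 0 k ω) ∂P
  have h1 := (summable_real_active hX hJ hB).hasSum.mul_right (∑ k, p k * z k)
  -- Correction for the first `m` epochs, which pull `k₀` instead of an arm drawn from `p`.
  have h2 : HasSum (fun n => if n < m then z k₀ - ∑ k, p k * z k else 0)
      (m * (z k₀ - ∑ k, p k * z k)) := by
    have := hasSum_sum_of_ne_finset_zero (L := .unconditional ℕ)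
      (f := fun n => if n < m then z k₀ - ∑ k, p k * z k else 0) (s := Finset.range m)
      fun n hn => if_neg (by simpa using hn)
    rwa [Finset.sum_congr rfl fun n hn => if_pos (Finset.mem_range.1 hn), Finset.sum_const,
      Finset.card_range, nsmul_eq_mul] at this
  have hval : m * z k₀ + ((∑' n, P.real (M.active (delayed m k₀ I) B n)) - m) * ∑ k, p k * z k =
      (∑' n, P.real (M.active (delayed m k₀ I) B n)) * ∑ k, p k * z k +
        m * (z k₀ - ∑ k, p k * z k) := by ring
  rw [hval]
  refine (congrArg (HasSum · _) (funext fun n => ?_)).mpr (h1.add h2)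
  by_cases h : n < m
  -- As `m ≤ B` and costs are at most 1, none of the first `m` epochs can be cut off.
  · have hu : M.active (delayed m k₀ I) B n = Set.univ :=
      active_eq_univ _ ((Nat.cast_le.2 h.le).trans hm)
    have hk : ∀ k, P.real (Set.univ ∩ {ω | delayed m k₀ I n ω = k}) * z k =
        if k₀ = k then z k else 0 := fun k => by
      by_cases hk : k₀ = k <;> simp [delayed, h, hk]
    rw [hu, if_pos h, Finset.sum_congr rfl fun k _ => hk k]
    simp
  · rw [if_neg h, add_zero, Finset.mul_sum]
    refine Finset.sum_congr rfl fun k _ => ?_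
    rw [real_active_inter_delayed hI (not_lt.1 h), mul_assoc]

/-! ### Rewards, penalties and rates -/

lemma integrable_totalReward [IsProbabilityMeasure P] (hX : ∀ k, 0 < ∫ ω, M.X 0 k ω ∂P)
    {J : ℕ → Ω → Fin K} (hJ : M.IsCausal J) {B : ℝ} (hB : 0 < B) :
    Integrable (M.totalReward J B) P :=
  (integrable_total_and_hasSum hX hJ hB (g := fun t => t.2.1) (by fun_prop)
    fun n k ω => M.R_mem n k ω).1

lemma integrable_totalPenalty [IsProbabilityMeasure P] (hX : ∀ k, 0 < ∫ ω, M.X 0 k ω ∂P)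
    {J : ℕ → Ω → Fin K} (hJ : M.IsCausal J) {B : ℝ} (hB : 0 < B) :
    Integrable (M.totalPenalty J B) P :=
  (integrable_total_and_hasSum hX hJ hB (g := fun t => t.2.2) (by fun_prop)
    fun n k ω => M.Y_mem n k ω).1

lemma integral_totalReward [IsProbabilityMeasure P] (hX : ∀ k, 0 < ∫ ω, M.X 0 k ω ∂P)
    {J : ℕ → Ω → Fin K} (hJ : M.IsCausal J) {B : ℝ} (hB : 0 < B) :
    ∫ ω, M.totalReward J B ω ∂P = ∑ k, M.expectedPulls J B k * ∫ ω, M.R 0 k ω ∂P :=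
  integral_total hX hJ hB (g := fun t => t.2.1) (by fun_prop) fun n k ω => M.R_mem n k ω

lemma integral_totalPenalty [IsProbabilityMeasure P] (hX : ∀ k, 0 < ∫ ω, M.X 0 k ω ∂P)
    {J : ℕ → Ω → Fin K} (hJ : M.IsCausal J) {B : ℝ} (hB : 0 < B) :
    ∫ ω, M.totalPenalty J B ω ∂P = ∑ k, M.expectedPulls J B k * ∫ ω, M.Y 0 k ω ∂P :=
  integral_total hX hJ hB (g := fun t => t.2.2) (by fun_prop) fun n k ω => M.Y_mem n k ω

/-- The expected total cost exceeds the budget by at most `1`. -/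
lemma sum_expectedPulls_cost_mem [IsProbabilityMeasure P] (hX : ∀ k, 0 < ∫ ω, M.X 0 k ω ∂P)
    {J : ℕ → Ω → Fin K} (hJ : M.IsCausal J) {B : ℝ} (hB : 0 < B) :
    ∑ k, M.expectedPulls J B k * ∫ ω, M.X 0 k ω ∂P ∈ Set.Ioc B (B + 1) := by
  have h := integral_total_cost_mem hX hJ hB
  rwa [integral_total hX hJ hB measurable_fst fun n k ω => M.X_mem n k ω] at h

lemma mem_feasible_iff {c B : ℝ} (hB : 0 < B) (J : ℕ → Ω → Fin K) :
    J ∈ M.feasible c B ↔ M.IsCausal J ∧ ∫ ω, M.totalPenalty J B ω ∂P ≤ c * B := by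
  rw [feasible, Set.mem_ofPred_eq, integral_const_mul, one_div_mul_eq_div, div_le_iff₀ hB]

lemma integral_totalReward_nonneg (J : ℕ → Ω → Fin K) (B : ℝ) :
    0 ≤ ∫ ω, M.totalReward J B ω ∂P :=
  integral_nonneg fun ω => Finset.sum_nonneg fun i _ => (M.R_mem i (J i ω) ω).1

lemma integral_R_nonneg (k : Fin K) : 0 ≤ ∫ ω, M.R 0 k ω ∂P :=
  integral_nonneg fun ω => (M.R_mem 0 k ω).1

lemma integral_Y_nonneg (k : Fin K) : 0 ≤ ∫ ω, M.Y 0 k ω ∂P :=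
  integral_nonneg fun ω => (M.Y_mem 0 k ω).1

lemma sum_cost_pos (hX : ∀ k, 0 < ∫ ω, M.X 0 k ω ∂P) {p : Fin K → ℝ}
    (hp : p ∈ stdSimplex ℝ (Fin K)) : 0 < ∑ k, p k * ∫ ω, M.X 0 k ω ∂P := by
  have hne : ∃ k ∈ Finset.univ, p k ≠ 0 := by
    refine Finset.exists_ne_zero_of_sum_ne_zero (s := Finset.univ) ?_
    rw [hp.2]
    exact one_ne_zero
  obtain ⟨k, hk, hpk⟩ := hne
  exact Finset.sum_pos' (fun i _ => mul_nonneg (hp.1 i) (hX i).le)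
    ⟨k, hk, mul_pos (lt_of_le_of_ne (hp.1 k) hpk.symm) (hX k)⟩

lemma rewardRate_nonneg (hX : ∀ k, 0 < ∫ ω, M.X 0 k ω ∂P) {p : Fin K → ℝ}
    (hp : p ∈ stdSimplex ℝ (Fin K)) : 0 ≤ M.rewardRate p :=
  div_nonneg (Finset.sum_nonneg fun k _ => mul_nonneg (hp.1 k) (integral_R_nonneg k))
    (sum_cost_pos hX hp).le

lemma penaltyRate_nonneg (hX : ∀ k, 0 < ∫ ω, M.X 0 k ω ∂P) {p : Fin K → ℝ}
    (hp : p ∈ stdSimplex ℝ (Fin K)) : 0 ≤ M.penaltyRate p :=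
  div_nonneg (Finset.sum_nonneg fun k _ => mul_nonneg (hp.1 k) (integral_Y_nonneg k))
    (sum_cost_pos hX hp).le

/-! ### Upper bound on the optimum -/

/-- No feasible policy earns more than the optimal rate times the largest possible cost. -/
lemma integral_totalReward_le_of_feasible [IsProbabilityMeasure P]
    (hX : ∀ k, 0 < ∫ ω, M.X 0 k ω ∂P) {c : ℝ} {p : Fin K → ℝ}
    (hp : M.IsOptimalDistribution c p) {B : ℝ} (hB : 0 < B) {J : ℕ → Ω → Fin K}
    (hJ : J ∈ M.feasible c B) :
    ∫ ω, M.totalReward J B ω ∂P ≤ M.rewardRate p * (B + 1) := by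
  obtain ⟨hJc, hJp⟩ := (mem_feasible_iff hB J).1 hJ
  have hc : 0 ≤ c := (penaltyRate_nonneg hX hp.1.1).trans hp.1.2
  obtain ⟨hx1, hx2⟩ := sum_expectedPulls_cost_mem hX hJc hB
  rw [integral_totalPenalty hX hJc hB] at hJp
  rw [integral_totalReward hX hJc hB]
  set T := M.expectedPulls J B with hT
  have hT0 : ∀ k, 0 ≤ T k := expectedPulls_nonneg J B
  set x := fun k => ∫ ω, M.X 0 k ω ∂P with hx
  have hXpos : 0 < ∑ k, T k * x k := hB.trans hx1
  have hS : 0 < ∑ k, T k := by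
    refine lt_of_le_of_ne (Finset.sum_nonneg fun k _ => hT0 k) fun h0 => ?_
    have hz := (Finset.sum_eq_zero_iff_of_nonneg fun k _ => hT0 k).1 h0.symm
    rw [Finset.sum_eq_zero fun k hk => by rw [hz k hk, zero_mul]] at hXpos
    exact lt_irrefl _ hXpos
  set S := ∑ k, T k with hSdef
  set q : Fin K → ℝ := fun k => T k / S with hq
  have hqs : ∀ z : Fin K → ℝ, ∑ k, q k * z k = (∑ k, T k * z k) / S := fun z => by
    rw [Finset.sum_div]
    exact Finset.sum_congr rfl fun k _ => by rw [hq]; ring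
  have hqmem : q ∈ stdSimplex ℝ (Fin K) := by
    refine ⟨fun k => div_nonneg (hT0 k) hS.le, ?_⟩
    rw [hq, ← Finset.sum_div, div_self hS.ne']
  have hpen : M.penaltyRate q ≤ c := by
    rw [penaltyRate, hqs, hqs, div_div_div_cancel_right₀ hS.ne', div_le_iff₀ hXpos]
    -- Here `c ≥ 0` matters: the penalty is at most `c B`, and `B` is below the expected cost.
    exact hJp.trans (mul_le_mul_of_nonneg_left hx1.le hc)
  have hrew := hp.2 q hqmem hpen
  rw [rewardRate, hqs, hqs, div_div_div_cancel_right₀ hS.ne', div_le_iff₀ hXpos] at hrew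
  exact hrew.trans (mul_le_mul_of_nonneg_left hx2 (rewardRate_nonneg hX hp.1.1))

lemma bddAbove_feasibleValues [IsProbabilityMeasure P] (hX : ∀ k, 0 < ∫ ω, M.X 0 k ω ∂P) {c : ℝ}
    {p : Fin K → ℝ} (hp : M.IsOptimalDistribution c p) {B : ℝ} (hB : 0 < B) :
    BddAbove (M.feasibleValues c B) := by
  refine ⟨M.rewardRate p * (B + 1), ?_⟩
  rintro _ ⟨J, hJ, rfl⟩
  exact integral_totalReward_le_of_feasible hX hp hB hJ

lemma opt_le [IsProbabilityMeasure P] (hX : ∀ k, 0 < ∫ ω, M.X 0 k ω ∂P) {c : ℝ}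
    {p : Fin K → ℝ} (hp : M.IsOptimalDistribution c p) {B : ℝ} (hB : 0 < B)
    (hne : (M.feasible c B).Nonempty) : M.opt c B ≤ M.rewardRate p * (B + 1) := by
  refine csSup_le (hne.image _) ?_
  rintro _ ⟨J, hJ, rfl⟩
  exact integral_totalReward_le_of_feasible hX hp hB hJ

lemma le_opt [IsProbabilityMeasure P] (hX : ∀ k, 0 < ∫ ω, M.X 0 k ω ∂P) {c : ℝ}
    {p : Fin K → ℝ} (hp : M.IsOptimalDistribution c p) {B : ℝ} (hB : 0 < B) {J : ℕ → Ω → Fin K}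
    (hJ : J ∈ M.feasible c B) : ∫ ω, M.totalReward J B ω ∂P ≤ M.opt c B :=
  le_csSup (bddAbove_feasibleValues hX hp hB) ⟨J, hJ, rfl⟩

/-! ### Regret and violation of the stationary policy -/

/-- Payoffs of a delayed stationary randomized policy, in terms of its expected total cost `S`. -/
lemma exists_integral_delayed [IsProbabilityMeasure P] (hX : ∀ k, 0 < ∫ ω, M.X 0 k ω ∂P)
    {p : Fin K → ℝ} (hp : p ∈ stdSimplex ℝ (Fin K)) {I : ℕ → Ω → Fin K}
    (hI : M.IsStationaryRandomized p I) {m : ℕ} (k₀ : Fin K) {B : ℝ} (hB : 0 < B)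
    (hm : (m : ℝ) ≤ B) :
    ∃ S ∈ Set.Ioc B (B + 1),
      ∫ ω, M.totalReward (delayed m k₀ I) B ω ∂P = m * ∫ ω, M.R 0 k₀ ω ∂P +
        M.rewardRate p * (S - m * ∫ ω, M.X 0 k₀ ω ∂P) ∧
      ∫ ω, M.totalPenalty (delayed m k₀ I) B ω ∂P = m * ∫ ω, M.Y 0 k₀ ω ∂P +
        M.penaltyRate p * (S - m * ∫ ω, M.X 0 k₀ ω ∂P) := by
  obtain ⟨A, hA⟩ := exists_integral_total_delayed hX hI k₀ hB hm
  have hS := integral_total_cost_mem hX (isCausal_delayed hI m k₀) hB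
  have hx := hA Prod.fst measurable_fst fun n k ω => M.X_mem n k ω
  have hr := hA (fun t => t.2.1) (by fun_prop) fun n k ω => M.R_mem n k ω
  have hy := hA (fun t => t.2.2) (by fun_prop) fun n k ω => M.Y_mem n k ω
  have hpos := sum_cost_pos hX hp
  have hx' : ∫ ω, M.total Prod.fst (delayed m k₀ I) B ω ∂P - m * ∫ ω, M.X 0 k₀ ω ∂P =
      (A - m) * ∑ k, p k * ∫ ω, M.X 0 k ω ∂P := by
    rw [hx]
    simp only [outcome]
    ring
  refine ⟨_, hS, hr.trans ?_, hy.trans ?_⟩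
  · rw [hx', rewardRate, mul_left_comm, div_mul_cancel₀ _ hpos.ne']
    rfl
  · rw [hx', penaltyRate, mul_left_comm, div_mul_cancel₀ _ hpos.ne']
    rfl

lemma exists_integral_stationary [IsProbabilityMeasure P] (hX : ∀ k, 0 < ∫ ω, M.X 0 k ω ∂P)
    {p : Fin K → ℝ} (hp : p ∈ stdSimplex ℝ (Fin K)) {I : ℕ → Ω → Fin K}
    (hI : M.IsStationaryRandomized p I) {B : ℝ} (hB : 0 < B) :
    ∃ S ∈ Set.Ioc B (B + 1), ∫ ω, M.totalReward I B ω ∂P = M.rewardRate p * S ∧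
      ∫ ω, M.totalPenalty I B ω ∂P = M.penaltyRate p * S := by
  have hne : Nonempty (Fin K) := by
    by_contra h
    rw [not_nonempty_iff] at h
    simpa using hp.2
  obtain ⟨k₀⟩ := hne
  obtain ⟨S, hS, h⟩ := exists_integral_delayed hX hp hI (m := 0) k₀ hB (by simpa using hB.le)
  rw [delayed_zero] at h
  exact ⟨S, hS, by simpa using h⟩

/-- Under the Slater condition, pulling the Slater arm a bounded number of times restores
feasibility at a bounded loss of reward. -/
lemma exists_feasible_of_slater [IsProbabilityMeasure P] (hX : ∀ k, 0 < ∫ ω, M.X 0 k ω ∂P)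
    {c : ℝ} {p : Fin K → ℝ} (hp : M.IsOptimalDistribution c p) {I : ℕ → Ω → Fin K}
    (hI : M.IsStationaryRandomized p I) {k₀ : Fin K}
    (hk : ∫ ω, M.Y 0 k₀ ω ∂P < c * ∫ ω, M.X 0 k₀ ω ∂P) :
    ∃ m : ℕ, ∀ B : ℝ, 0 < B → (m : ℝ) ≤ B → ∃ J ∈ M.feasible c B,
      M.rewardRate p * (B - m) ≤ ∫ ω, M.totalReward J B ω ∂P := by
  set δ := c * ∫ ω, M.X 0 k₀ ω ∂P - ∫ ω, M.Y 0 k₀ ω ∂P with hδ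
  have hδ0 : 0 < δ := sub_pos.2 hk
  -- Each pull of the Slater arm saves `δ` of penalty against the rate `c`, and the overshoot of the
  -- budget costs at most `c`; so `m δ ≥ c` suffices.
  obtain ⟨m, hm⟩ := exists_nat_ge (c / δ)
  rw [div_le_iff₀ hδ0] at hm
  refine ⟨m, fun B hB hmB => ⟨delayed m k₀ I, ?_⟩⟩
  obtain ⟨S, ⟨hS1, hS2⟩, hr, hy⟩ := exists_integral_delayed hX hp.1.1 hI k₀ hB hmB
  have hc : 0 ≤ c := (penaltyRate_nonneg hX hp.1.1).trans hp.1.2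
  have hr0 := rewardRate_nonneg hX hp.1.1
  have hx1 : ∫ ω, M.X 0 k₀ ω ∂P ≤ 1 := by
    have h := integral_mono_of_nonneg (μ := P) (ae_of_all _ fun ω => (M.X_mem 0 k₀ ω).1)
      (integrable_const (1 : ℝ)) (ae_of_all _ fun ω => (M.X_mem 0 k₀ ω).2)
    simpa using h
  have hmx : m * ∫ ω, M.X 0 k₀ ω ∂P ≤ m := mul_le_of_le_one_right (Nat.cast_nonneg m) hx1
  constructor
  · refine (mem_feasible_iff hB _).2 ⟨isCausal_delayed hI m k₀, ?_⟩
    rw [hy]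
    have h1 : M.penaltyRate p * (S - m * ∫ ω, M.X 0 k₀ ω ∂P) ≤
        c * (S - m * ∫ ω, M.X 0 k₀ ω ∂P) :=
      mul_le_mul_of_nonneg_right hp.1.2 (by linarith)
    have h2 : c * S ≤ c * (B + 1) := mul_le_mul_of_nonneg_left hS2 hc
    rw [hδ] at hm
    linarith
  · rw [hr]
    have h1 : M.rewardRate p * (B - m) ≤ M.rewardRate p * (S - m * ∫ ω, M.X 0 k₀ ω ∂P) :=
      mul_le_mul_of_nonneg_left (by linarith) hr0
    have h2 : 0 ≤ m * ∫ ω, M.R 0 k₀ ω ∂P := mul_nonneg (Nat.cast_nonneg m) (integral_R_nonneg k₀)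
    linarith

/-- Without the Slater condition, the existence of a feasible policy makes every stationary
randomized policy of penalty rate at most `c` feasible. -/
lemma mem_feasible_of_not_slater [IsProbabilityMeasure P] (hX : ∀ k, 0 < ∫ ω, M.X 0 k ω ∂P)
    {c : ℝ} {p : Fin K → ℝ} (hp : p ∈ stdSimplex ℝ (Fin K)) (hpc : M.penaltyRate p ≤ c)
    {I : ℕ → Ω → Fin K} (hI : M.IsStationaryRandomized p I)
    (hk : ∀ k, c * ∫ ω, M.X 0 k ω ∂P ≤ ∫ ω, M.Y 0 k ω ∂P) {B : ℝ} (hB : 0 < B)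
    (hne : (M.feasible c B).Nonempty) : I ∈ M.feasible c B := by
  obtain ⟨J, hJ⟩ := hne
  obtain ⟨hJc, hJp⟩ := (mem_feasible_iff hB J).1 hJ
  have hy0 := penaltyRate_nonneg hX hp
  -- If `c > 0`, every causal policy pays at least `c` times its expected cost, which is strictly
  -- more than `c B`.
  have hc : c ≤ 0 := by
    by_contra! hc
    have h1 := (sum_expectedPulls_cost_mem hX hJc hB).1
    have h2 : c * ∑ k, M.expectedPulls J B k * ∫ ω, M.X 0 k ω ∂P ≤
        ∑ k, M.expectedPulls J B k * ∫ ω, M.Y 0 k ω ∂P := by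
      rw [Finset.mul_sum]
      refine Finset.sum_le_sum fun k _ => ?_
      rw [mul_left_comm]
      exact mul_le_mul_of_nonneg_left (hk k) (expectedPulls_nonneg J B k)
    rw [← integral_totalPenalty hX hJc hB] at h2
    exact absurd (h2.trans hJp) (not_le.2 (mul_lt_mul_of_pos_left h1 hc))
  have hc0 : c = 0 := le_antisymm hc (hy0.trans hpc)
  subst hc0
  obtain ⟨S, -, -, hy⟩ := exists_integral_stationary hX hp hI hB
  refine (mem_feasible_iff hB _).2 ⟨isCausal_of_measurable_seed hI.seed_measurable, ?_⟩
  rw [hy, le_antisymm hpc hy0, zero_mul, zero_mul]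

/-- The optimum is at most `r(p) (B + 1)`, and the stationary policy earns between `r(p) B` and
`r(p) (B + 1)`. The Slater case uses a feasible competitor to bound the optimum below; in the other
case the stationary policy is feasible, so its regret is nonnegative. -/
lemma exists_abs_regret_le [IsProbabilityMeasure P] (hX : ∀ k, 0 < ∫ ω, M.X 0 k ω ∂P)
    {c : ℝ} {p : Fin K → ℝ} (hp : M.IsOptimalDistribution c p) {I : ℕ → Ω → Fin K}
    (hI : M.IsStationaryRandomized p I) :
    ∃ C : ℝ, ∀ B : ℝ, 0 < B → (M.feasible c B).Nonempty → |M.regret c I B| ≤ C := by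
  have hr0 := rewardRate_nonneg hX hp.1.1
  by_cases hs : ∃ k, ∫ ω, M.Y 0 k ω ∂P < c * ∫ ω, M.X 0 k ω ∂P
  · obtain ⟨k₀, hk₀⟩ := hs
    obtain ⟨m, hm⟩ := exists_feasible_of_slater hX hp hI hk₀
    refine ⟨M.rewardRate p * (m + 1), fun B hB hne => ?_⟩
    obtain ⟨S, ⟨hS1, hS2⟩, hr, -⟩ := exists_integral_stationary hX hp.1.1 hI hB
    have h1 := opt_le hX hp hB hne
    -- For `B < m` the left side is nonpositive, so any feasible policy will do.
    have h2 : M.rewardRate p * (B - m) ≤ M.opt c B := by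
      rcases le_total (m : ℝ) B with hmB | hmB
      · obtain ⟨J, hJ, hJr⟩ := hm B hB hmB
        exact hJr.trans (le_opt hX hp hB hJ)
      · obtain ⟨J, hJ⟩ := hne
        exact (mul_nonpos_of_nonneg_of_nonpos hr0 (by linarith)).trans
          ((integral_totalReward_nonneg J B).trans (le_opt hX hp hB hJ))
    have h3 := mul_le_mul_of_nonneg_left hS1.le hr0
    have h4 := mul_le_mul_of_nonneg_left hS2 hr0
    have h5 : 0 ≤ M.rewardRate p * m := mul_nonneg hr0 (Nat.cast_nonneg m)
    rw [regret, hr, abs_le]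
    constructor <;> linarith
  · push Not at hs
    refine ⟨M.rewardRate p, fun B hB hne => ?_⟩
    obtain ⟨S, ⟨hS1, hS2⟩, hr, -⟩ := exists_integral_stationary hX hp.1.1 hI hB
    have h1 := opt_le hX hp hB hne
    have h2 := le_opt hX hp hB
      (mem_feasible_of_not_slater hX hp.1.1 hp.1.2 hI hs hB hne)
    have h3 := mul_le_mul_of_nonneg_left hS1.le hr0
    rw [hr] at h2
    rw [regret, hr, abs_le]
    constructor <;> linarith

/-- The violation is `(y(p) S - c B) / B` with `B < S ≤ B + 1`. If `y(p) = c` it is nonnegative, so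
the upper bound also bounds its absolute value. -/
lemma violation_le [IsProbabilityMeasure P] (hX : ∀ k, 0 < ∫ ω, M.X 0 k ω ∂P)
    {c : ℝ} {p : Fin K → ℝ} (hp : M.IsOptimalDistribution c p) {I : ℕ → Ω → Fin K}
    (hI : M.IsStationaryRandomized p I) {B : ℝ} (hB : 0 < B) :
    M.violation c I B ≤ c / B ∧ (M.penaltyRate p = c → |M.violation c I B| ≤ c / B) := by
  obtain ⟨S, ⟨hS1, hS2⟩, -, hy⟩ := exists_integral_stationary hX hp.1.1 hI hB
  have hy0 := penaltyRate_nonneg hX hp.1.1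
  have hc : 0 ≤ c := hy0.trans hp.1.2
  have hv : M.violation c I B = (M.penaltyRate p * S - c * B) / B := by
    rw [violation, integral_const_mul, hy, one_div_mul_eq_div, sub_div, mul_div_cancel_right₀ _ hB.ne']
  have hle : M.violation c I B ≤ c / B := by
    rw [hv]
    refine div_le_div_of_nonneg_right ?_ hB.le
    have h1 : M.penaltyRate p * S ≤ c * (B + 1) :=
      mul_le_mul hp.1.2 hS2 (hB.trans hS1).le hc
    linarith
  refine ⟨hle, fun heq => ?_⟩
  have hnn : 0 ≤ M.violation c I B := by
    rw [hv, heq]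
    exact div_nonneg (sub_nonneg.2 (mul_le_mul_of_nonneg_left hS1.le hc)) hB.le
  rwa [abs_of_nonneg hnn]

end BanditModel

/-! ### Assembly of the theorem -/

theorem proposition1 {K : ℕ} {Ω : Type*} [MeasurableSpace Ω] (P : Measure Ω)
    [IsProbabilityMeasure P] {𝒰 : Type*} [MeasurableSpace 𝒰] (M : BanditModel K P 𝒰)
    (hX : ∀ k, 0 < ∫ ω, M.X 0 k ω ∂P) (c : ℝ)
    (p : Fin K → ℝ) (hp : M.IsOptimalDistribution c p)
    (I : ℕ → Ω → Fin K) (hI : M.IsStationaryRandomized p I) :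
    -- the quantities below are well defined for every causal policy, and `I` is one of them
    (∀ J, M.IsCausal J → ∀ B : ℝ, 0 < B →
      (∀ᵐ ω ∂P, ∃ n, B < M.cost J n ω) ∧
      Integrable (M.totalReward J B) P ∧ Integrable (M.totalPenalty J B) P) ∧
    M.IsCausal I ∧
    (∀ B : ℝ, 0 < B → BddAbove (M.feasibleValues c B)) ∧
    -- under the Slater condition the constrained problem is feasible for all large budgets
    ((∃ k, ∫ ω, M.Y 0 k ω ∂P < c * ∫ ω, M.X 0 k ω ∂P) →
      ∀ᶠ B : ℝ in atTop, (M.feasible c B).Nonempty) ∧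
    -- the regret is `O(1)`
    (∃ C : ℝ, ∀ B : ℝ, 0 < B → (M.feasible c B).Nonempty → |M.regret c I B| ≤ C) ∧
    -- the constraint-violation is `O(1/B)`, on both sides if the penalty constraint is active
    (∃ C : ℝ, ∀ B : ℝ, 0 < B → M.violation c I B ≤ C / B ∧
      (M.penaltyRate p = c → |M.violation c I B| ≤ C / B)) ∧
    -- asymptotic optimality
    Tendsto (fun B : ℝ => M.regret c I B / B)
      (atTop ⊓ 𝓟 {B : ℝ | (M.feasible c B).Nonempty}) (𝓝 0) ∧
    Tendsto (fun B : ℝ => max (M.violation c I B) 0) atTop (𝓝 0) ∧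
    (M.penaltyRate p = c → Tendsto (fun B : ℝ => M.violation c I B) atTop (𝓝 0)) := by

  obtain ⟨C, hC⟩ := BanditModel.exists_abs_regret_le hX hp hI
  have hv := fun (B : ℝ) (hB : 0 < B) => BanditModel.violation_le hX hp hI hB
  have hdiv : ∀ D : ℝ, Tendsto (fun B : ℝ => D / B) atTop (𝓝 0) := fun D =>
    tendsto_const_nhds.div_atTop tendsto_id
  refine ⟨fun J hJ B hB => ⟨BanditModel.ae_exists_lt_cost hX hJ hB,
      BanditModel.integrable_totalReward hX hJ hB, BanditModel.integrable_totalPenalty hX hJ hB⟩,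
    BanditModel.isCausal_of_measurable_seed hI.seed_measurable,
    fun B hB => BanditModel.bddAbove_feasibleValues hX hp hB, ?_, ⟨C, hC⟩, ⟨c, hv⟩, ?_, ?_, ?_⟩
  · rintro ⟨k, hk⟩
    obtain ⟨m, hm⟩ := BanditModel.exists_feasible_of_slater hX hp hI hk
    filter_upwards [eventually_gt_atTop 0, eventually_ge_atTop (m : ℝ)] with B hB hmB
    obtain ⟨J, hJ, -⟩ := hm B hB hmB
    exact ⟨J, hJ⟩
  · refine squeeze_zero_norm' ?_ ((hdiv C).mono_left inf_le_left)
    filter_upwards [mem_inf_of_left (eventually_gt_atTop 0), mem_inf_of_right (mem_principal_self _)]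
      with B hB hne
    have hB' : 0 < B := hB
    rw [norm_div, Real.norm_eq_abs, Real.norm_eq_abs, abs_of_pos hB']
    exact div_le_div_of_nonneg_right (hC B hB' hne) hB'.le
  · have hmax : Tendsto (fun B : ℝ => max (c / B) 0) atTop (𝓝 0) := by
      simpa using (hdiv c).max (tendsto_const_nhds (x := (0 : ℝ)))
    refine squeeze_zero' (Eventually.of_forall fun B => le_max_right _ _) ?_ hmax
    filter_upwards [eventually_gt_atTop 0] with B hB
    exact max_le_max_right _ (hv B hB).1
  · intro heq
    refine squeeze_zero_norm' ?_ (hdiv c)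
    filter_upwards [eventually_gt_atTop 0] with B hB using (hv B hB).2 heq
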